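/- Let $k$ be an algebraically closed field and let $R$ be a (not necessarily commutative) associative unital $k$-algebra which is finite dimensional over $k$. Let $\mathcal A=\operatorname{mod} R$ be the category of finitely generated right $R$-modules, and assume that $R$ is of finite representation type, i.e. that $\mathcal A$ has only finitely many isomorphism classes of indecomposable objects. Let $\operatorname{Mod}\mathcal A$ be the category of additive functors $\mathcal A^{op}\to \mathbf{Ab}$ (with natural transformations), and let $\operatorname{mod}\mathcal A$ be its full subcategory of functors of finite type, i.e. quotients of finite direct sums of representable functors $\mathcal A(\cdot,V)$. Let $K_0(\mathcal A^{split})$ be the quotient of the free abelian group on the isomorphism classes $[V]$ of objects of $\mathcal A$ by the relations $[V]=[V']+[V'']$ for all split short exact sequences $0\to V'\to V\to V''\to 0$ in $\mathcal A$, and let $K_0(\operatorname{mod}\mathcal A)$ be the quotient of the free abelian group on the isomorphism classes of objects of $\operatorname{mod}\mathcal A$ by the analogous relations for all short exact sequences in $\operatorname{mod}\mathcal A$. Then: (i) $\mathcal A$ is right noetherian, that is, for every object $V$ of $\mathcal A$ the functor $\mathcal A(\cdot,V)$ is a noetherian object of $\operatorname{Mod}\mathcal A$; (ii) the Yoneda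 embedding $\mathcal A\to\operatorname{mod}\mathcal A$, $V\mapsto\mathcal A(\cdot,V)$, induces an isomorphism of abelian groups $$K_0(\mathcal A^{split})\;\simeq\; K_0(\operatorname{mod}\mathcal A),\qquad [V]\mapsto[\mathcal A(\cdot,V)];$$ (iii) two finitely generated right $R$-modules $V$ and $V'$ are isomorphic if and only if $[\mathcal A(\cdot,V)]=[\mathcal A(\cdot,V')]$ in $K_0(\operatorname{mod}\mathcal A)$. -/

import Mathlib

open CategoryTheory CategoryTheory.Limits

universe v u w

noncomputable section

/-! ### Grothendieck groups -/

/-- The isomorphism classes of objects of a category. -/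
abbrev IsoClasses (C : Type u) [Category.{v} C] : Type u :=
  Quotient (isIsomorphicSetoid C)

/-- The Grothendieck group of a category `C` with respect to a class `E` of short complexes
(its short exact sequences): the quotient of the free abelian group on the isomorphism classes
`[V]` of objects by the subgroup generated by the elements `[V] - ([V'] + [V''])`, one for each
sequence `V' ⟶ V ⟶ V''` in `E`. -/
def K0 {C : Type u} [Category.{v} C] [Preadditive C] (E : ObjectProperty (ShortComplex C)) :
    Type u :=
  FreeAbelianGroup (IsoClasses C) ⧸
    AddSubgroup.closure {x : FreeAbelianGroup (IsoClasses C) | ∃ S : ShortComplex C, E S ∧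
      x = FreeAbelianGroup.of (Quotient.mk _ S.X₂) -
        (FreeAbelianGroup.of (Quotient.mk _ S.X₁) + FreeAbelianGroup.of (Quotient.mk _ S.X₃))}

instance {C : Type u} [Category.{v} C] [Preadditive C] (E : ObjectProperty (ShortComplex C)) :
    AddCommGroup (K0 E) :=
  inferInstanceAs (AddCommGroup (FreeAbelianGroup (IsoClasses C) ⧸ _))

/-- The class `[V]` of an object `V` in the Grothendieck group. -/
def K0.mk {C : Type u} [Category.{v} C] [Preadditive C] (E : ObjectProperty (ShortComplex C))
    (V : C) : K0 E :=
  QuotientAddGroup.mk (FreeAbelianGroup.of (Quotient.mk _ V))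

/-- The split exact structure: the sequences `0 ⟶ V' ⟶ V ⟶ V'' ⟶ 0` that split. -/
def splitExact (C : Type u) [Category.{v} C] [Preadditive C] : ObjectProperty (ShortComplex C) :=
  fun S ↦ Nonempty S.Splitting

/-- The canonical exact structure of an abelian category: all the short exact sequences
`0 ⟶ V' ⟶ V ⟶ V'' ⟶ 0`. -/
def allExact (C : Type u) [Category.{v} C] [Preadditive C] : ObjectProperty (ShortComplex C) :=
  fun S ↦ S.ShortExact

/-! ### Modules over a ring with several objects -/

/-- Additive functors are closed under limits in the category of functors. -/
instance additiveFunctor_isClosedUnderLimitsOfShape (C : Type*) (D : Type*) (J : Type*)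
    [Category* C] [Category* D] [Category* J] [Preadditive C] [Preadditive D]
    [HasLimitsOfShape J D] : (additiveFunctor C D).IsClosedUnderLimitsOfShape J where
  limitsOfShape_le := by
    rintro X ⟨p⟩
    refine ⟨fun {Y Z f g} ↦ ?_⟩
    refine (isLimitOfPreserves ((evaluation C D).obj Z) p.isLimit).hom_ext fun j ↦ ?_
    have : (p.diag.obj j).Additive := p.prop_diag_obj j
    simp [Preadditive.add_comp]

instance additiveFunctor_isClosedUnderFiniteProducts (C : Type*) (D : Type*)
    [Category* C] [Category* D] [Preadditive C] [Preadditive D] [HasFiniteProducts D] :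
    (additiveFunctor C D).IsClosedUnderFiniteProducts where
  isClosedUnderLimitsOfShape J _ := additiveFunctor_isClosedUnderLimitsOfShape C D (Discrete J)

/-- The category `Mod A` of (right) `A`-modules: additive contravariant functors
from `A` to abelian groups. -/
abbrev ModuleOver (A : Type u) [Category.{v} A] [Preadditive A] : Type max u (v + 1) :=
  Aᵒᵖ ⥤+ AddCommGrpCat.{v}

instance (A : Type u) [Category.{v} A] [Preadditive A] : HasFiniteBiproducts (ModuleOver A) :=
  HasFiniteBiproducts.of_hasFiniteProducts

/-- The Yoneda embedding `A ⥤ Mod A`, `V ↦ A(·, V)`. -/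
def representable (A : Type u) [Category.{v} A] [Preadditive A] : A ⥤ ModuleOver A :=
  (additiveFunctor Aᵒᵖ AddCommGrpCat.{v}).lift preadditiveYoneda
    fun V ↦ inferInstanceAs (preadditiveYoneda.obj V).Additive

/-- A category is right noetherian if each `A(·, V)` is a noetherian object of `Mod A`. -/
def IsRightNoetherian (A : Type u) [Category.{v} A] [Preadditive A] : Prop :=
  ∀ V : A, IsNoetherianObject ((representable A).obj V)

/-- An `A`-module is of finite type if it is a quotient of a finite direct sum
of representable functors. -/
def isFiniteType (A : Type u) [Category.{v} A] [Preadditive A] : ObjectProperty (ModuleOver A) :=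
  fun F ↦ ∃ (n : ℕ) (V : Fin n → A) (p : (⨁ fun i ↦ (representable A).obj (V i)) ⟶ F), Epi p

/-- The category `mod A` of `A`-modules of finite type. -/
abbrev FiniteTypeModule (A : Type u) [Category.{v} A] [Preadditive A] : Type max u (v + 1) :=
  (isFiniteType A).FullSubcategory

lemma isFiniteType_representable {A : Type u} [Category.{v} A] [Preadditive A] (V : A) :
    isFiniteType A ((representable A).obj V) :=
  ⟨1, fun _ ↦ V, biproduct.π (fun _ : Fin 1 ↦ (representable A).obj V) 0, inferInstance⟩

/-- The Yoneda embedding `A ⥤ mod A`, `V ↦ A(·, V)`. -/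
def yonedaFiniteType (A : Type u) [Category.{v} A] [Preadditive A] : A ⥤ FiniteTypeModule A :=
  (isFiniteType A).lift (representable A) isFiniteType_representable

/-! ### Algebras of finite representation type -/

instance isFG_isClosedUnderFiniteProducts (R : Type u) [Ring R] :
    (ModuleCat.isFG.{w} R).IsClosedUnderFiniteProducts where
  isClosedUnderLimitsOfShape J _ := by
    refine ⟨?_⟩
    rintro X ⟨p⟩
    have (j : J) : Module.Finite R (p.diag.obj ⟨j⟩) := p.prop_diag_obj ⟨j⟩
    let e : X ≅ ∏ᶜ fun j ↦ p.diag.obj ⟨j⟩ :=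
      p.isLimit.conePointsIsoOfNatIso (limit.isLimit _) Discrete.natIsoFunctor
    rw [ModuleCat.isFG_iff]
    exact Module.Finite.equiv e.symm.toLinearEquiv

/-- The category of right `R`-modules of finite type (a right `R`-module is a module over the
opposite ring `Rᵐᵒᵖ`). -/
abbrev RightMod (R : Type u) [Ring R] : Type (u + 1) :=
  FGModuleCat.{u} Rᵐᵒᵖ

instance (R : Type u) [Ring R] : HasBinaryBiproducts (RightMod R) :=
  HasBinaryBiproducts.of_hasBinaryProducts

/-- `R` is of finite representation type if there are only finitely many isomorphism classes
of indecomposable right `R`-modules of finite type. -/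
def FiniteRepresentationType (R : Type u) [Ring R] : Prop :=
  {c : IsoClasses (RightMod R) | ∃ V : RightMod R, Indecomposable V ∧ Quotient.mk _ V = c}.Finite

end

/-! Only a few features of the module category matter: it is a `k`-linear category with
finite-dimensional Hom spaces, kernels, cokernels and finite direct sums, and it has finitely many
indecomposables `N i` up to isomorphism. Each additive functor `F` on it takes values in `k`-vector
spaces.

Noetherianity: every object is a finite direct sum of indecomposables, so a submodule of `F` is
determined by its sections on the `N i` (`le_of_forall_indecomposable_le`). Hence `F` has finite
type exactly when its sections are finite-dimensional, finite type passes to submodules, and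
subobjects embed strictly monotonically into a finite product of subspace lattices.

Surjectivity: cover `F` by `A(·, V)` and the kernel, again of finite type, by `A(·, U)`. By Yoneda
this comes from some `u : U ⟶ V`, and left exactness of Hom gives a resolution `0 ⟶ A(·, ker u) ⟶
A(·, U) ⟶ A(·, V) ⟶ F ⟶ 0`, so `[F] = [V] - [U] + [ker u]`.

Injectivity and (iii): `dim F(X)` is additive on short exact sequences, so equal classes of `A(·,
V)` and `A(·, V')` force `dim (X, V) = dim (X, V')` for all `X`. Bongartz's theorem
(`nonempty_iso_of_finrank_hom_eq`) then gives `V ≅ V'`. Every element of the split group is a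
difference `[V] - [V']`, so the kernel is trivial. -/

open scoped ZeroObject

noncomputable section

/-! ### Finite-dimensional algebras without nontrivial idempotents -/

/-- A finite-dimensional algebra without nontrivial idempotents is a local ring. -/
theorem isLocalRing_of_trivial_idempotents {k E : Type*} [Field k] [Ring E] [Algebra k E]
    [Module.Finite k E] [Nontrivial E]
    (h : ∀ e : E, IsIdempotentElem e → e = 0 ∨ e = 1) : IsLocalRing E := by
  have key (a : E) : IsNilpotent a ∨ IsUnit a := by
    -- Fitting's lemma for left multiplication by `a`: the decomposition `1 = e + f` along `ker ⊕
    -- range` of `a ^ n` yields an idempotent `e`. The bound `1 ≤ n` lets one factor `a` be split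
    -- off `a ^ n` below.
    obtain ⟨n, hn⟩ := ((LinearMap.mulLeft k a).eventually_isCompl_ker_pow_range_pow.and
      (Filter.eventually_ge_atTop 1)).exists
    obtain ⟨hn, hn1⟩ := hn
    rw [LinearMap.pow_mulLeft] at hn
    have htop : (1 : E) ∈ LinearMap.ker (LinearMap.mulLeft k (a ^ n)) ⊔
        LinearMap.range (LinearMap.mulLeft k (a ^ n)) := by
      rw [hn.sup_eq_top]; trivial
    obtain ⟨e, he, f, ⟨g, hg⟩, hef⟩ := Submodule.mem_sup.1 htop
    rw [LinearMap.mem_ker, LinearMap.mulLeft_apply] at he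
    rw [LinearMap.mulLeft_apply] at hg
    have hfe : f * e = 0 := by
      refine Submodule.disjoint_def.1 hn.disjoint _ ?_ ⟨g * e, ?_⟩
      · have : f * e = e - e * e := by
          rw [eq_sub_iff_add_eq', ← add_mul, hef, one_mul]
        rw [LinearMap.mem_ker, LinearMap.mulLeft_apply, this, mul_sub, ← mul_assoc, he]
        simp
      · rw [LinearMap.mulLeft_apply, ← hg, mul_assoc]
    have hid : IsIdempotentElem e := by
      have : (e + f) * e = e := by rw [hef, one_mul]
      rwa [add_mul, hfe, add_zero] at this
    rcases h e hid with rfl | rfl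
    · right
      rw [zero_add] at hef
      subst hef
      have ha : a * (a ^ (n - 1) * g) = 1 := by
        rw [← mul_assoc, ← pow_succ', Nat.sub_add_cancel hn1, hg]
      have : IsArtinianRing E := IsArtinianRing.of_finite k E
      exact .of_mul_eq_one _ ha
    · left
      exact ⟨n, by simpa using he⟩
  refine .of_isUnit_or_isUnit_one_sub_self fun a ↦ ?_
  rcases key a with ha | ha
  · exact .inr ha.isUnit_one_sub
  · exact .inl ha

theorem IsLocalRing.exists_isUnit_of_isUnit_sum {E ι : Type*} [Ring E] [IsLocalRing E]
    (s : Finset ι) (g : ι → E) (h : IsUnit (∑ i ∈ s, g i)) : ∃ i ∈ s, IsUnit (g i) := by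
  classical
  induction s using Finset.induction_on with
  | empty => simp at h
  | insert i s hi ih =>
    rw [Finset.sum_insert hi] at h
    obtain ⟨u, hu⟩ := h
    have h1 : ↑u⁻¹ * g i + ↑u⁻¹ * ∑ j ∈ s, g j = 1 := by rw [← mul_add, ← hu, Units.inv_mul]
    rcases IsLocalRing.isUnit_or_isUnit_of_add_one h1 with h2 | h2
    · exact ⟨i, by simp, by simpa using h2⟩
    · obtain ⟨j, hj, hj'⟩ := ih (by simpa using h2)
      exact ⟨j, by simp [hj], hj'⟩

/-! ### Indecomposable objects of a Hom-finite category -/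

namespace CategoryTheory

variable {A : Type u} [Category.{v} A] [Preadditive A]

/-- A split epimorphism with a kernel splits off its target as a direct summand. -/
def isoBiprodKernelOfRetraction [HasBinaryBiproducts A] {X Z : A} (s : X ⟶ Z) (r : Z ⟶ X)
    [HasKernel r] (h : s ≫ r = 𝟙 X) : Z ≅ X ⊞ kernel r :=
  (ShortComplex.Splitting.isoBinaryBiproduct
    (S := ShortComplex.mk (kernel.ι r) r (kernel.condition r))
    { r := kernel.lift r (𝟙 Z - r ≫ s) (by simp [h])
      s := s
      f_r := by
        ext
        simp
      s_g := h
      id := by simp }) ≪≫ biprod.braiding _ _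

/-- Kernels split idempotents: `ker (1 - e)` is the image of `e`, hence a direct summand of `X`, and
either it or its complement vanishes. -/
theorem Indecomposable.eq_zero_or_eq_id [HasBinaryBiproducts A] [HasKernels A] {X : A}
    (hX : Indecomposable X) (e : X ⟶ X) (he : e ≫ e = e) : e = 0 ∨ e = 𝟙 X := by
  let r : X ⟶ kernel (𝟙 X - e) := kernel.lift _ e (by simp [he])
  have hr : r ≫ kernel.ι (𝟙 X - e) = e := kernel.lift_ι _ _ _
  have hι : kernel.ι (𝟙 X - e) ≫ e = kernel.ι (𝟙 X - e) := by
    have := kernel.condition (𝟙 X - e)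
    rw [Preadditive.comp_sub, Category.comp_id, sub_eq_zero] at this
    exact this.symm
  have hs : kernel.ι (𝟙 X - e) ≫ r = 𝟙 _ := by
    rw [← cancel_mono (kernel.ι (𝟙 X - e)), Category.assoc, hr, hι, Category.id_comp]
  rcases hX.2 _ _ (isoBiprodKernelOfRetraction _ r hs) with h | h
  · left
    rw [← hr, h.eq_of_tgt r 0, zero_comp]
  · right
    have h0 : (𝟙 X - e) ≫ r = 0 := by
      rw [← cancel_mono (kernel.ι (𝟙 X - e)), Category.assoc, hr]
      simp [he]
    have : 𝟙 X - e = 0 := by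
      rw [← kernel.lift_ι r _ h0, h.eq_of_tgt (kernel.lift r _ h0) 0, zero_comp]
    exact (sub_eq_zero.1 this).symm

variable (k : Type w) [Field k] [Linear k A]

theorem finrank_hom_congr {X X' Y Y' : A} (e : X ≅ X') (e' : Y ≅ Y') :
    Module.finrank k (X ⟶ Y) = Module.finrank k (X' ⟶ Y') :=
  (Linear.homCongr k e e').finrank_eq

variable [∀ X Y : A, Module.Finite k (X ⟶ Y)]

theorem finrank_hom_biprod [HasBinaryBiproducts A] (Z X Y : A) :
    Module.finrank k (Z ⟶ X ⊞ Y) = Module.finrank k (Z ⟶ X) + Module.finrank k (Z ⟶ Y) := by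
  rw [← Module.finrank_prod]
  exact LinearEquiv.finrank_eq
    { toFun f := (f ≫ biprod.fst, f ≫ biprod.snd)
      invFun f := biprod.lift f.1 f.2
      map_add' _ _ := by simp
      map_smul' _ _ := by simp
      left_inv f := by apply biprod.hom_ext <;> simp
      right_inv f := by simp }

/-- For `f : M ⟶ Z`, the sequence `0 ⟶ (cokernel f, T) ⟶ (Z, T) ⟶ (M, T)` is exact. -/
theorem finrank_cokernel_hom_add_finrank_range [HasCokernels A] {M Z : A} (f : M ⟶ Z) (T : A) :
    Module.finrank k (cokernel f ⟶ T) +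
      Module.finrank k (LinearMap.range (Linear.leftComp k T f)) = Module.finrank k (Z ⟶ T) := by
  rw [← LinearMap.finrank_range_add_finrank_ker (Linear.leftComp k T f), add_comm]
  congr 1
  rw [← LinearMap.finrank_range_of_inj (f := Linear.leftComp k T (cokernel.π f))
    fun a b h ↦ by rwa [Linear.leftComp_apply, Linear.leftComp_apply, cancel_epi] at h]
  suffices h : LinearMap.range (Linear.leftComp k T (cokernel.π f)) =
      LinearMap.ker (Linear.leftComp k T f) by rw [h]
  ext g
  simp only [LinearMap.mem_range, LinearMap.mem_ker, Linear.leftComp_apply]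
  refine ⟨?_, fun h ↦ ⟨cokernel.desc f g h, by simp⟩⟩
  rintro ⟨g, rfl⟩
  simp

theorem finrank_end_pos {X : A} (hX : ¬ IsZero X) : 0 < Module.finrank k (X ⟶ X) := by
  have : Nontrivial (X ⟶ X) := ⟨𝟙 X, 0, fun h ↦ hX ((IsZero.iff_id_eq_zero X).2 h)⟩
  exact Module.finrank_pos

variable [HasBinaryBiproducts A]

/-- The projections of `Z` embed `(X, X)` and `(Y, Y)` into `(Z, X)` and `(Z, Y)`, and `(Y, Y)` is
nonzero. Thus the dimension of the endomorphism space serves as induction measure. -/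
theorem finrank_end_lt_of_iso_biprod {X Y Z : A} (e : Z ≅ X ⊞ Y) (hY : ¬ IsZero Y) :
    Module.finrank k (X ⟶ X) < Module.finrank k (Z ⟶ Z) := by
  have h1 : Module.finrank k (X ⟶ X) ≤ Module.finrank k (Z ⟶ X) :=
    LinearMap.finrank_le_finrank_of_injective (f := Linear.leftComp k X (e.hom ≫ biprod.fst))
      fun f g h ↦ by
        rwa [Linear.leftComp_apply, Linear.leftComp_apply, cancel_epi] at h
  have h2 : Module.finrank k (Y ⟶ Y) ≤ Module.finrank k (Z ⟶ Y) :=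
    LinearMap.finrank_le_finrank_of_injective (f := Linear.leftComp k Y (e.hom ≫ biprod.snd))
      fun f g h ↦ by
        rwa [Linear.leftComp_apply, Linear.leftComp_apply, cancel_epi] at h
  rw [finrank_hom_congr k (Iso.refl Z) e, finrank_hom_biprod]
  have := finrank_end_pos k hY
  omega

include k in
/-- Induction on objects of a Hom-finite category: a property which is stable under isomorphisms
and finite direct sums and holds for the indecomposable objects holds for all objects. -/
theorem indecomposable_induction {P : A → Prop} (iso : ∀ {X Y : A}, (X ≅ Y) → P X → P Y)
    (zero : ∀ X, IsZero X → P X) (sum : ∀ X Y, P X → P Y → P (X ⊞ Y))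
    (indec : ∀ X, Indecomposable X → P X) (X : A) : P X := by
  induction hn : Module.finrank k (X ⟶ X) using Nat.strong_induction_on generalizing X with
  | _ n ih =>
    by_cases h0 : IsZero X
    · exact zero X h0
    by_cases hX : Indecomposable X
    · exact indec X hX
    simp only [Indecomposable, not_and, not_forall, not_or] at hX
    obtain ⟨Y, Z, e, hY, hZ⟩ := hX h0
    refine iso e.symm (sum _ _ (ih _ ?_ Y rfl) (ih _ ?_ Z rfl))
    · exact hn ▸ finrank_end_lt_of_iso_biprod k e hZ
    · exact hn ▸ finrank_end_lt_of_iso_biprod k (e ≪≫ biprod.braiding _ _) hY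

include k in
theorem exists_indecomposable_retract (X : A) (hX : ¬ IsZero X) :
    ∃ (Y : A) (s : Y ⟶ X) (r : X ⟶ Y), Indecomposable Y ∧ s ≫ r = 𝟙 Y := by
  refine indecomposable_induction k (P := fun X ↦ ¬ IsZero X →
    ∃ (Y : A) (s : Y ⟶ X) (r : X ⟶ Y), Indecomposable Y ∧ s ≫ r = 𝟙 Y) ?_ ?_ ?_ ?_ X hX
  · intro X X' e h hX
    obtain ⟨Y, s, r, hY, hsr⟩ := h fun h ↦ hX (h.of_iso e.symm)
    exact ⟨Y, s ≫ e.hom, e.inv ≫ r, hY, by simp [hsr]⟩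
  · exact fun X h hX ↦ (hX h).elim
  · intro X Y hX' hY' hX
    by_cases h : IsZero X
    · have h' : ¬ IsZero Y := fun h' ↦ hX (by
        rw [IsZero.iff_id_eq_zero]
        apply biprod.hom_ext'
        · exact h.eq_of_src _ _
        · exact h'.eq_of_src _ _)
      obtain ⟨Z, s, r, hZ, hsr⟩ := hY' h'
      exact ⟨Z, s ≫ biprod.inr, biprod.snd ≫ r, hZ, by simp [hsr]⟩
    · obtain ⟨Z, s, r, hZ, hsr⟩ := hX' h
      exact ⟨Z, s ≫ biprod.inl, biprod.fst ≫ r, hZ, by simp [hsr]⟩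
  · exact fun X h _ ↦ ⟨X, 𝟙 X, 𝟙 X, h, by simp⟩

variable [HasKernels A]

include k in
theorem Indecomposable.isLocalRing_end {X : A} (hX : Indecomposable X) : IsLocalRing (End X) := by
  have : Module.Finite k (End X) := inferInstanceAs (Module.Finite k (X ⟶ X))
  have : Nontrivial (End X) := ⟨𝟙 X, 0, fun h ↦ hX.1 ((IsZero.iff_id_eq_zero X).2 h)⟩
  exact isLocalRing_of_trivial_idempotents (k := k) fun e he ↦ hX.eq_zero_or_eq_id e he

variable [HasFiniteBiproducts A]

include k in
/-- An indecomposable retract of a finite direct sum is a retract of one of the summands. -/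
theorem Indecomposable.exists_retract_of_biproduct {X : A} (hX : Indecomposable X) {n : ℕ}
    {N : Fin n → A} (s : X ⟶ ⨁ N) (r : ⨁ N ⟶ X) (h : s ≫ r = 𝟙 X) :
    ∃ (i : Fin n) (s' : X ⟶ N i) (r' : N i ⟶ X), s' ≫ r' = 𝟙 X := by
  have := hX.isLocalRing_end k
  -- In the local ring `End X` one of these summands is a unit; its inverse corrects the map back to
  -- `X` into a retraction.
  have hsum : (∑ i, (show End X from (s ≫ biproduct.π N i) ≫ (biproduct.ι N i ≫ r))) = 1 := by
    have : s ≫ (∑ i, biproduct.π N i ≫ biproduct.ι N i) ≫ r = 𝟙 X := by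
      rw [biproduct.total, Category.id_comp, h]
    rw [Preadditive.sum_comp, Preadditive.comp_sum] at this
    simpa using this
  obtain ⟨i, -, hi⟩ := IsLocalRing.exists_isUnit_of_isUnit_sum _ _ (hsum ▸ isUnit_one)
  obtain ⟨u, hu⟩ := hi
  refine ⟨i, s ≫ biproduct.π N i, (biproduct.ι N i ≫ r) ≫ (↑u⁻¹ : End X), ?_⟩
  have := u.inv_mul
  rw [hu] at this
  simpa [End.mul_def] using this

variable [HasCokernels A]

omit [HasBinaryBiproducts A] [HasKernels A] in
/-- If `(X, M)` and `(X, N)` have the same dimension for all `X`, then `M` is a retract of a finite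
direct sum of copies of `N`. -/
theorem exists_retract_of_finrank_hom_eq {M N : A}
    (h : ∀ X : A, Module.finrank k (X ⟶ M) = Module.finrank k (X ⟶ N)) :
    ∃ (n : ℕ) (s : M ⟶ ⨁ fun _ : Fin n ↦ N) (r : (⨁ fun _ : Fin n ↦ N) ⟶ M), s ≫ r = 𝟙 M := by
  -- A basis of `(M, N)` assembles into a map `f` to a power of `N` through which every map `M ⟶ N`
  -- factors.
  let b := Module.finBasis k (M ⟶ N)
  let f : M ⟶ ⨁ fun _ ↦ N := biproduct.lift b
  have hN : LinearMap.range (Linear.leftComp k N f) = ⊤ := by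
    rw [eq_top_iff]
    intro g _
    refine ⟨biproduct.desc fun i ↦ b.repr g i • 𝟙 N, ?_⟩
    rw [Linear.leftComp_apply, biproduct.lift_desc]
    simp [b.sum_repr g]
  -- Comparing the two left exact sequences, with the hypothesis at `cokernel f` and at the power of
  -- `N`, gives equal ranges for targets `M` and `N`. The hypothesis at `M` turns this rank into
  -- `dim (M, M)`, so `𝟙 M` factors through `f`.
  have hM : LinearMap.range (Linear.leftComp k M f) = ⊤ := by
    refine Submodule.eq_top_of_finrank_eq ?_
    have h1 := finrank_cokernel_hom_add_finrank_range k f M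
    have h2 := finrank_cokernel_hom_add_finrank_range k f N
    rw [hN, finrank_top] at h2
    have := h (cokernel f)
    have := h (⨁ fun _ : Fin (Module.finrank k (M ⟶ N)) ↦ N)
    have := h M
    omega
  obtain ⟨r, hr⟩ : 𝟙 M ∈ LinearMap.range (Linear.leftComp k M f) := hM ▸ trivial
  exact ⟨_, f, r, hr⟩

/-- **Bongartz's theorem**: in a Hom-finite category with kernels and cokernels, an object `M` is
determined up to isomorphism by the dimensions of the spaces `(X, M)`. -/
theorem nonempty_iso_of_finrank_hom_eq {M N : A}
    (h : ∀ X : A, Module.finrank k (X ⟶ M) = Module.finrank k (X ⟶ N)) : Nonempty (M ≅ N) := by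
  induction hn : Module.finrank k (M ⟶ M) using Nat.strong_induction_on generalizing M N with
  | _ n ih =>
    by_cases hM : IsZero M
    · have hN : IsZero N := by
        by_contra hN
        have := finrank_end_pos k hN
        rw [← h N, Module.finrank_pos_iff] at this
        exact not_subsingleton _ ⟨fun a b : N ⟶ M ↦ hM.eq_of_tgt a b⟩
      exact ⟨hM.iso hN⟩
    obtain ⟨X, s, r, hX, hsr⟩ := exists_indecomposable_retract k M hM
    -- The summand `X` of `M` is a retract of a power of `N`, hence of `N` itself. Splitting `X` off
    -- both objects preserves the equality of dimensions, so the complements are isomorphic by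
    -- induction.
    obtain ⟨m, s', r', hsr'⟩ := exists_retract_of_finrank_hom_eq k h
    obtain ⟨_, t, q, htq⟩ := hX.exists_retract_of_biproduct k (s ≫ s') (r' ≫ r) (by
      rw [Category.assoc, reassoc_of% hsr', hsr])
    let e := isoBiprodKernelOfRetraction s r hsr
    let e' := isoBiprodKernelOfRetraction t q htq
    have hlt := finrank_end_lt_of_iso_biprod k (e ≪≫ biprod.braiding _ _) hX.1
    obtain ⟨i⟩ := ih _ (hn ▸ hlt) (M := kernel r) (N := kernel q) (fun Y ↦ by
      have := h Y
      rw [finrank_hom_congr k (Iso.refl Y) e, finrank_hom_congr k (Iso.refl Y) e',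
        finrank_hom_biprod, finrank_hom_biprod] at this
      omega) rfl
    exact ⟨e ≪≫ biprod.mapIso (Iso.refl X) i ≪≫ e'.symm⟩

end CategoryTheory

/-! ### Sections of a module over a ring with several objects -/

namespace ModuleOver

open Opposite

variable {A : Type u} [Category.{v} A] [Preadditive A]

/-- The abelian group `F(X)`. -/
def Sections (F : ModuleOver A) (X : A) : Type v := F.obj.obj (op X)

instance (F : ModuleOver A) (X : A) : AddCommGroup (F.Sections X) :=
  inferInstanceAs (AddCommGroup (F.obj.obj (op X)))

/-- The map `F(Y) → F(X)` induced by `f : X ⟶ Y`. -/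
def restrict (F : ModuleOver A) {X Y : A} (f : X ⟶ Y) : F.Sections Y →+ F.Sections X :=
  (F.obj.map f.op).hom

section

variable (F : ModuleOver A) {X Y Z : A}

@[simp]
theorem restrict_id (x : F.Sections X) : F.restrict (𝟙 X) x = x :=
  congr($(F.obj.map_id (op X)) x)

theorem restrict_comp (f : X ⟶ Y) (g : Y ⟶ Z) (x : F.Sections Z) :
    F.restrict (f ≫ g) x = F.restrict f (F.restrict g x) :=
  congr($(F.obj.map_comp g.op f.op) x)

theorem restrict_add (f g : X ⟶ Y) (x : F.Sections Y) :
    F.restrict (f + g) x = F.restrict f x + F.restrict g x := by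
  have := F.property
  exact congr($(F.property.map_add (f := f.op) (g := g.op)) x)

/-- The evaluation of `F` on morphisms as a homomorphism. -/
def restrictHom (x : F.Sections Y) : (X ⟶ Y) →+ F.Sections X :=
  AddMonoidHom.mk' (fun f ↦ F.restrict f x) fun f g ↦ F.restrict_add f g x

theorem restrict_zero (x : F.Sections Y) : F.restrict (0 : X ⟶ Y) x = 0 :=
  (F.restrictHom x).map_zero

end

variable {F G H : ModuleOver A}

/-- The components of a morphism of modules. -/
def app (f : F ⟶ G) (X : A) : F.Sections X →+ G.Sections X := (f.hom.app (op X)).hom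

theorem app_restrict (f : F ⟶ G) {X Y : A} (g : X ⟶ Y) (x : F.Sections Y) :
    app f X (F.restrict g x) = G.restrict g (app f Y x) :=
  congr($(f.hom.naturality g.op) x)

theorem hom_ext {f g : F ⟶ G} (h : ∀ X x, app f X x = app g X x) : f = g := by
  apply InducedCategory.hom_ext
  ext X x
  exact h X.unop x

/-- A natural family of homomorphisms is a morphism of modules. -/
def mkHom (φ : ∀ X, F.Sections X →+ G.Sections X)
    (h : ∀ ⦃X Y : A⦄ (g : X ⟶ Y) (x : F.Sections Y),
      φ X (F.restrict g x) = G.restrict g (φ Y x)) : F ⟶ G :=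
  ObjectProperty.homMk
    { app X := AddCommGrpCat.ofHom (φ X.unop)
      naturality X Y g := by
        ext x
        exact h g.unop x }

theorem mono_of_injective (f : F ⟶ G) (hf : ∀ X, Function.Injective (app f X)) : Mono f where
  right_cancellation _ _ h := hom_ext fun X x ↦ hf X congr(app $h X x)

theorem epi_of_surjective (f : F ⟶ G) (hf : ∀ X, Function.Surjective (app f X)) : Epi f where
  left_cancellation _ _ h := hom_ext fun X x ↦ by
    obtain ⟨x, rfl⟩ := hf X x
    exact congr(app $h X x)

/-- Morphisms factor through injective morphisms with larger image. -/
theorem exists_lift (f : F ⟶ G) (hf : ∀ X, Function.Injective (app f X)) (g : H ⟶ G)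
    (hg : ∀ X x, ∃ y, app f X y = app g X x) : ∃ l : H ⟶ F, l ≫ f = g := by
  choose φ hφ using hg
  refine ⟨mkHom (fun X ↦ AddMonoidHom.mk' (φ X) fun x y ↦ hf X ?_) fun X Y g x ↦ hf X ?_,
    hom_ext fun X x ↦ hφ X x⟩
  · simp [hφ]
  · simp [hφ, app_restrict]

/-- Morphisms factor through surjective morphisms with smaller kernel. -/
theorem exists_desc (f : F ⟶ G) (hf : ∀ X, Function.Surjective (app f X)) (g : F ⟶ H)
    (hg : ∀ X x, app f X x = 0 → app g X x = 0) : ∃ d : G ⟶ H, f ≫ d = g := by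
  choose φ hφ using hf
  have key (X : A) (x y : F.Sections X) (h : app f X x = app f X y) : app g X x = app g X y := by
    rw [← sub_eq_zero, ← map_sub]
    exact hg X _ (by rw [map_sub, h, sub_self])
  refine ⟨mkHom (fun X ↦ AddMonoidHom.mk' (fun y ↦ app g X (φ X y)) fun x y ↦ ?_)
    fun X Y u x ↦ ?_, hom_ext fun X x ↦ key X _ _ (hφ X _)⟩
  · rw [← map_add]
    exact key X _ _ (by simp [hφ])
  · simp only [AddMonoidHom.mk'_apply]
    rw [← app_restrict]
    exact key X _ _ (by simp [hφ, app_restrict])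

/-- The morphism `A(·, X) ⟶ F` corresponding to an element of `F(X)`. -/
def ofSection {X : A} (x : F.Sections X) : (representable A).obj X ⟶ F :=
  mkHom (fun _ ↦ F.restrictHom x) fun _ _ g f ↦ F.restrict_comp g f x

@[simp]
theorem app_ofSection {X Y : A} (x : F.Sections X) (f : Y ⟶ X) :
    app (ofSection x) Y f = F.restrict f x := rfl

theorem ofSection_eq_zero_iff {X : A} (x : F.Sections X) : ofSection x = 0 ↔ x = 0 := by
  refine ⟨fun h ↦ ?_, ?_⟩
  · rw [← F.restrict_id x]
    exact congr(app $h X (𝟙 X))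
  · rintro rfl
    exact hom_ext fun Y f ↦ (F.restrict f).map_zero

theorem ofSection_comp {X : A} (x : F.Sections X) (f : F ⟶ G) :
    ofSection x ≫ f = ofSection (app f X x) :=
  hom_ext fun _ g ↦ app_restrict f g x

/-! ### Submodules and quotient modules -/

/-- A family of subgroups which is stable under restriction. -/
def IsSubmodule (F : ModuleOver A) (K : ∀ X, AddSubgroup (F.Sections X)) : Prop :=
  ∀ ⦃X Y : A⦄ (f : X ⟶ Y), ∀ x ∈ K Y, F.restrict f x ∈ K X

section

variable {K : ∀ X, AddSubgroup (F.Sections X)} (hK : F.IsSubmodule K)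

/-- A submodule as a module. -/
def ofSubmodule : ModuleOver A where
  obj :=
    { obj X := AddCommGrpCat.of (K X.unop)
      map f := AddCommGrpCat.ofHom (((F.restrict f.unop).comp (K _).subtype).codRestrict _
        fun x ↦ hK f.unop x.1 x.2)
      map_id X := AddCommGrpCat.hom_ext <| AddMonoidHom.ext fun x : K X.unop ↦
        Subtype.ext (F.restrict_id x.1)
      map_comp {X _ _} f g := AddCommGrpCat.hom_ext <| AddMonoidHom.ext fun x : K X.unop ↦
        Subtype.ext (F.restrict_comp g.unop f.unop x.1) }
  property := ⟨fun {X _ f g} ↦ AddCommGrpCat.hom_ext <| AddMonoidHom.ext fun x : K X.unop ↦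
    Subtype.ext (F.restrict_add f.unop g.unop x.1)⟩

/-- The inclusion of a submodule. -/
def submoduleι : ofSubmodule hK ⟶ F := mkHom (fun X ↦ (K X).subtype) fun _ _ _ _ ↦ rfl

theorem submoduleι_injective (X : A) : Function.Injective (app (submoduleι hK) X) :=
  Subtype.val_injective

theorem exists_app_submoduleι_iff {X : A} (x : F.Sections X) :
    (∃ y, app (submoduleι hK) X y = x) ↔ x ∈ K X :=
  ⟨fun ⟨y, hy⟩ ↦ hy ▸ y.2, fun h ↦ ⟨⟨x, h⟩, rfl⟩⟩

/-- The quotient by a submodule. -/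
def quotient : ModuleOver A where
  obj :=
    { obj X := AddCommGrpCat.of (F.Sections X.unop ⧸ K X.unop)
      map f := AddCommGrpCat.ofHom
        (QuotientAddGroup.map _ _ (F.restrict f.unop) fun x hx ↦ hK f.unop x hx)
      map_id X := by
        ext x
        exact congr(QuotientAddGroup.mk $(F.restrict_id x))
      map_comp f g := by
        ext x
        exact congr(QuotientAddGroup.mk $(F.restrict_comp g.unop f.unop x)) }
  property := ⟨fun {X Y f g} ↦ by
    ext x
    exact congr(QuotientAddGroup.mk $(F.restrict_add f.unop g.unop x))⟩

/-- The projection onto a quotient module. -/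
def quotientπ : F ⟶ quotient hK :=
  mkHom (fun X ↦ QuotientAddGroup.mk' (K X)) fun _ _ _ _ ↦ rfl

theorem quotientπ_surjective (X : A) : Function.Surjective (app (quotientπ hK) X) :=
  QuotientAddGroup.mk'_surjective _

theorem app_quotientπ_eq_zero_iff {X : A} (x : F.Sections X) :
    app (quotientπ hK) X x = 0 ↔ x ∈ K X :=
  QuotientAddGroup.eq_zero_iff x

end

theorem isSubmodule_range (f : F ⟶ G) : G.IsSubmodule fun X ↦ (app f X).range := by
  rintro X Y g _ ⟨x, rfl⟩
  exact ⟨F.restrict g x, app_restrict f g x⟩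

theorem isSubmodule_ker (f : F ⟶ G) : F.IsSubmodule fun X ↦ (app f X).ker := by
  intro X Y g x hx
  rw [AddMonoidHom.mem_ker] at hx ⊢
  rw [app_restrict, hx, map_zero]

/-- By Yoneda, a section killed by `f` is a morphism from a representable whose composite with `f`
vanishes. -/
theorem injective_of_mono (f : F ⟶ G) [Mono f] (X : A) : Function.Injective (app f X) := by
  rw [injective_iff_map_eq_zero]
  intro x hx
  rw [← ofSection_eq_zero_iff, ← cancel_mono f, ofSection_comp, hx, zero_comp,
    ofSection_eq_zero_iff]

theorem surjective_of_quotientπ_eq_zero (f : F ⟶ G) (h : quotientπ (isSubmodule_range f) = 0)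
    (X : A) : Function.Surjective (app f X) := by
  intro y
  have := app_quotientπ_eq_zero_iff (isSubmodule_range f) y
  rw [h] at this
  exact this.1 rfl

theorem comp_quotientπ_range (f : F ⟶ G) : f ≫ quotientπ (isSubmodule_range f) = 0 :=
  hom_ext fun _ x ↦ (app_quotientπ_eq_zero_iff (isSubmodule_range f) _).2 ⟨x, rfl⟩

theorem surjective_of_epi (f : F ⟶ G) [Epi f] (X : A) : Function.Surjective (app f X) :=
  surjective_of_quotientπ_eq_zero f
    (by rw [← cancel_epi f, comp_quotientπ_range, comp_zero]) X

/-! ### Modules of finite type -/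

/-- A module is of finite type if and only if it is generated by a single section. -/
theorem isFiniteType_iff_exists_generator [HasFiniteBiproducts A] :
    isFiniteType A F ↔ ∃ (V : A) (x : F.Sections V),
      ∀ X (y : F.Sections X), ∃ f : X ⟶ V, F.restrict f x = y := by
  constructor
  · rintro ⟨n, V, p, hp⟩
    let x (i : Fin n) : F.Sections (V i) :=
      app (biproduct.ι (fun i ↦ (representable A).obj (V i)) i ≫ p) (V i) (𝟙 (V i))
    have hx (i : Fin n) : ofSection (x i) =
        biproduct.ι (fun i ↦ (representable A).obj (V i)) i ≫ p := hom_ext fun Y f ↦ by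
      exact (app_restrict (F := (representable A).obj (V i)) _ f (𝟙 (V i))).symm.trans
        (congrArg (app _ Y) (Category.comp_id (X := Y) (Y := V i) f))
    -- The sections `x i` over the `V i` combine into one over their direct sum, by pulling back
    -- along the projections.
    refine ⟨⨁ V, ∑ i, F.restrict (biproduct.π V i) (x i), fun X y ↦ ?_⟩
    obtain ⟨z, rfl⟩ := surjective_of_epi p X y
    let f (i : Fin n) : X ⟶ V i := app (biproduct.π (fun i ↦ (representable A).obj (V i)) i) X z
    refine ⟨biproduct.lift f, ?_⟩
    have h1 : p = ∑ i, biproduct.π (fun i ↦ (representable A).obj (V i)) i ≫ ofSection (x i) := by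
      simp_rw [hx, ← Category.assoc]
      rw [← Preadditive.sum_comp, biproduct.total, Category.id_comp]
    let ev : ((⨁ fun i ↦ (representable A).obj (V i)) ⟶ F) →+ F.Sections X :=
      AddMonoidHom.mk' (fun f ↦ app f X z) fun _ _ ↦ rfl
    have h2 : app p X z = ∑ i, F.restrict (f i) (x i) := by
      conv_lhs => rw [h1]
      exact map_sum ev _ _
    rw [h2, map_sum]
    refine Finset.sum_congr rfl fun i _ ↦ ?_
    rw [← restrict_comp, biproduct.lift_π]
  · rintro ⟨V, x, hx⟩
    refine ⟨1, fun _ ↦ V,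
      biproduct.π (fun _ : Fin 1 ↦ (representable A).obj V) 0 ≫ ofSection x, ?_⟩
    have : Epi (ofSection x) := epi_of_surjective _ hx
    exact epi_comp _ _

theorem isFiniteType_of_surjective [HasFiniteBiproducts A] (hF : isFiniteType A F) (f : F ⟶ G)
    (hf : ∀ X, Function.Surjective (app f X)) : isFiniteType A G := by
  rw [isFiniteType_iff_exists_generator] at hF ⊢
  obtain ⟨V, x, hx⟩ := hF
  refine ⟨V, app f V x, fun X y ↦ ?_⟩
  obtain ⟨y, rfl⟩ := hf X y
  obtain ⟨g, rfl⟩ := hx X y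
  exact ⟨g, (app_restrict f g x).symm⟩

/-! ### The linear structure on the sections -/

section Linear

variable {k : Type w} [Field k] [Linear k A]

/-- The scalars act through `F (c • 𝟙 X)`, so by naturality every morphism of modules is
automatically `k`-linear. -/
instance (F : ModuleOver A) (X : A) : Module k (F.Sections X) where
  smul c x := F.restrict (c • 𝟙 X) x
  one_smul x := by
    change F.restrict ((1 : k) • 𝟙 X) x = x
    simp
  mul_smul c d x := by
    change F.restrict ((c * d) • 𝟙 X) x = F.restrict (c • 𝟙 X) (F.restrict (d • 𝟙 X) x)
    rw [← restrict_comp]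
    simp [smul_smul, mul_comm]
  smul_zero c := map_zero _
  smul_add c := map_add _
  add_smul c d x := by
    change F.restrict ((c + d) • 𝟙 X) x = _
    rw [add_smul, restrict_add]
    rfl
  zero_smul x := by
    change F.restrict ((0 : k) • 𝟙 X) x = _
    rw [zero_smul, restrict_zero]

theorem restrict_smul (c : k) {X Y : A} (f : X ⟶ Y) (x : F.Sections Y) :
    F.restrict (c • f) x = c • F.restrict f x := by
  change _ = F.restrict (c • 𝟙 X) (F.restrict f x)
  rw [← restrict_comp]
  simp

variable (k) in
/-- The components of a morphism as linear maps. -/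
def linearApp (f : F ⟶ G) (X : A) : F.Sections X →ₗ[k] G.Sections X where
  __ := app f X
  map_smul' c x := app_restrict f (c • 𝟙 X) x

variable (k) in
/-- The evaluation of `F` on morphisms as a linear map. -/
def linearRestrict (F : ModuleOver A) {X Y : A} (x : F.Sections Y) : (X ⟶ Y) →ₗ[k] F.Sections X where
  __ := F.restrictHom x
  map_smul' c f := restrict_smul c f x

variable (k) in
/-- The sections of a representable module. -/
def sectionsRepresentable (V X : A) : ((representable A).obj V).Sections X ≃ₗ[k] (X ⟶ V) where
  toFun f := f
  invFun f := f
  map_add' _ _ := rfl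
  map_smul' c f := (Linear.smul_comp X X V c (𝟙 X) f).trans
    (congrArg (fun g : X ⟶ V ↦ c • g) (Category.id_comp (X := X) (Y := V) f))
  left_inv _ := rfl
  right_inv _ := rfl

theorem finite_sections [∀ X Y : A, Module.Finite k (X ⟶ Y)] [HasFiniteBiproducts A]
    (hF : isFiniteType A F) (X : A) : Module.Finite k (F.Sections X) := by
  obtain ⟨V, x, hx⟩ := isFiniteType_iff_exists_generator.1 hF
  exact Module.Finite.of_surjective (linearRestrict k F x) (hx X)

end Linear

end ModuleOver

/-! ### Short exact sequences of modules of finite type -/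

namespace FiniteTypeModule

open ModuleOver

variable {A : Type u} [Category.{v} A] [Preadditive A] {F G : FiniteTypeModule A}

/-- Here `f` is only a monomorphism among modules of finite type; this suffices because the test
objects are representable. -/
theorem injective_of_mono (f : F ⟶ G) [Mono f] (X : A) : Function.Injective (app f.hom X) := by
  rw [injective_iff_map_eq_zero]
  intro x hx
  let s : (yonedaFiniteType A).obj X ⟶ F := ObjectProperty.homMk (ofSection x)
  have : s ≫ f = 0 := InducedCategory.hom_ext <| by
    change ofSection x ≫ f.hom = 0
    rw [ofSection_comp, hx, ofSection_eq_zero_iff]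
  rw [← ofSection_eq_zero_iff]
  exact congr($((cancel_mono f).1 (this.trans zero_comp.symm)).hom)

variable [HasFiniteBiproducts A]

/-- The quotient of `G` by the image of `f` is again of finite type, so it is an admissible test
object. -/
theorem surjective_of_epi (f : F ⟶ G) [Epi f] (X : A) : Function.Surjective (app f.hom X) := by
  refine surjective_of_quotientπ_eq_zero _ ?_ X
  let Q : FiniteTypeModule A :=
    ⟨_, isFiniteType_of_surjective G.2 _ (quotientπ_surjective (isSubmodule_range f.hom))⟩
  let q : G ⟶ Q := ObjectProperty.homMk (quotientπ (isSubmodule_range f.hom))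
  have h : f ≫ q = 0 := InducedCategory.hom_ext (comp_quotientπ_range f.hom)
  have hq : q = 0 := (cancel_epi f).1 (h.trans comp_zero.symm)
  exact congrArg InducedCategory.Hom.hom hq

/-- Exactness supplies homology data in which `S.X₁` maps epimorphically, hence surjectively on
sections, to the kernel of `S.g`; a section killed by `S.g` factors through this kernel by Yoneda.
-/
theorem exists_app_eq_of_shortExact {S : ShortComplex (FiniteTypeModule A)} (hS : S.ShortExact)
    {X : A} (y : S.X₂.obj.Sections X) (hy : app S.g.hom X y = 0) : ∃ x, app S.f.hom X x = y := by
  obtain ⟨h, hH⟩ := hS.exact.condition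
  have := hS.exact.epi_f' h.left
  let s : (yonedaFiniteType A).obj X ⟶ S.X₂ := ObjectProperty.homMk (ofSection y)
  have hs : s ≫ S.g = 0 := InducedCategory.hom_ext <| by
    change ofSection y ≫ S.g.hom = 0
    rw [ofSection_comp, hy, ofSection_eq_zero_iff]
  obtain ⟨x, hx⟩ := surjective_of_epi h.left.f' X (app (h.left.liftK s hs).hom X (𝟙 X))
  refine ⟨x, ?_⟩
  have h1 : app S.f.hom X x = app (h.left.liftK s hs ≫ h.left.i).hom X (𝟙 X) := by
    rw [← h.left.f'_i]
    exact congr(app h.left.i.hom X $hx)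
  rw [h1, h.left.liftK_i]
  exact restrict_id _ y

theorem finrank_sections_of_shortExact (k : Type w) [Field k] [Linear k A]
    [∀ X Y : A, Module.Finite k (X ⟶ Y)] {S : ShortComplex (FiniteTypeModule A)}
    (hS : S.ShortExact) (X : A) : Module.finrank k (S.X₂.obj.Sections X) =
      Module.finrank k (S.X₁.obj.Sections X) + Module.finrank k (S.X₃.obj.Sections X) := by
  have := hS.mono_f
  have := hS.epi_g
  have := finite_sections (k := k) S.X₂.2 X
  have hf := injective_of_mono S.f X
  have hg := surjective_of_epi S.g X
  rw [← LinearMap.finrank_range_add_finrank_ker (linearApp k S.g.hom X), add_comm,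
    LinearMap.range_eq_top.2 hg, finrank_top,
    ← LinearMap.finrank_range_of_inj (f := linearApp k S.f.hom X) hf]
  suffices h : LinearMap.ker (linearApp k S.g.hom X) = LinearMap.range (linearApp k S.f.hom X) by
    rw [h]
  ext y
  refine ⟨fun h ↦ exists_app_eq_of_shortExact hS y h, ?_⟩
  rintro ⟨x, rfl⟩
  exact congr(app $(S.zero).hom X x)

omit [HasFiniteBiproducts A] in
theorem isZero_yoneda_of_isZero {Z : A} (hZ : IsZero Z) :
    IsZero ((yonedaFiniteType A).obj Z) := by
  rw [IsZero.iff_id_eq_zero]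
  exact InducedCategory.hom_ext <| hom_ext fun X f ↦ hZ.eq_of_tgt (Y := X) f 0

omit [HasFiniteBiproducts A] in
theorem shortExact_of_sections [HasZeroObject A] (S : ShortComplex (FiniteTypeModule A))
    (hf : ∀ X, Function.Injective (app S.f.hom X))
    (hfg : ∀ X y, app S.g.hom X y = 0 → ∃ x, app S.f.hom X x = y)
    (hg : ∀ X, Function.Surjective (app S.g.hom X)) : S.ShortExact := by
  have hmono : Mono S.f :=
    have := ModuleOver.mono_of_injective _ hf
    (isFiniteType A).ι.mono_of_mono_map this
  have hepi : Epi S.g :=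
    have := ModuleOver.epi_of_surjective _ hg
    (isFiniteType A).ι.epi_of_epi_map this
  have hker : IsLimit (KernelFork.ofι S.f S.zero) := by
    have key {W : FiniteTypeModule A} (h : W ⟶ S.X₂) (w : h ≫ S.g = 0) :
        ∃ l : W ⟶ S.X₁, l ≫ S.f = h := by
      obtain ⟨l, hl⟩ := exists_lift S.f.hom hf h.hom fun X x ↦ hfg X _ congr(app $(w).hom X x)
      exact ⟨ObjectProperty.homMk l, InducedCategory.hom_ext hl⟩
    exact KernelFork.IsLimit.ofι _ _ (fun h w ↦ (key h w).choose)
      (fun h w ↦ (key h w).choose_spec)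
      (fun h w m hm ↦ by rw [← cancel_mono S.f, hm, (key h w).choose_spec])
  have hcoker : IsColimit (CokernelCofork.ofπ S.g S.zero) := by
    have key {W : FiniteTypeModule A} (h : S.X₂ ⟶ W) (w : S.f ≫ h = 0) :
        ∃ d : S.X₃ ⟶ W, S.g ≫ d = h := by
      obtain ⟨d, hd⟩ := exists_desc S.g.hom hg h.hom fun X y hy ↦ by
        obtain ⟨x, rfl⟩ := hfg X y hy
        exact congr(app $(w).hom X x)
      exact ⟨ObjectProperty.homMk d, InducedCategory.hom_ext hd⟩
    exact CokernelCofork.IsColimit.ofπ _ _ (fun h w ↦ (key h w).choose)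
      (fun h w ↦ (key h w).choose_spec)
      (fun h w m hm ↦ by rw [← cancel_epi S.g, hm, (key h w).choose_spec])
  let Z := (yonedaFiniteType A).obj (0 : A)
  have hZ : IsZero Z := isZero_yoneda_of_isZero (isZero_zero A)
  -- With `S.X₁` as cycles and `S.X₃` as opcycles, the comparison maps `f'` and `g'` are identities,
  -- so the zero object is the homology on both sides.
  have hl : hker.lift (KernelFork.ofι S.f S.zero) = 𝟙 S.X₁ := by
    rw [← cancel_mono S.f]
    exact (hker.fac (KernelFork.ofι S.f S.zero) WalkingParallelPair.zero).trans
      (Category.id_comp _).symm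
  have hd : hcoker.desc (CokernelCofork.ofπ S.g S.zero) = 𝟙 S.X₃ := by
    rw [← cancel_epi S.g]
    exact (hcoker.fac (CokernelCofork.ofπ S.g S.zero) WalkingParallelPair.one).trans
      (Category.comp_id _).symm
  refine ShortComplex.ShortExact.mk' ⟨⟨
    { left :=
        { K := S.X₁
          H := Z
          i := S.f
          π := 0
          wi := S.zero
          hi := hker
          wπ := comp_zero
          hπ := CokernelCofork.IsColimit.ofEpiOfIsZero _ (by
            rw [hl]
            exact inferInstanceAs (Epi (𝟙 S.X₁))) hZ }
      right :=
        { Q := S.X₃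
          H := Z
          p := S.g
          ι := 0
          wp := S.zero
          hp := hcoker
          wι := zero_comp
          hι := KernelFork.IsLimit.ofMonoOfIsZero _ (by
            rw [hd]
            exact inferInstanceAs (Mono (𝟙 S.X₃))) hZ }
      iso := Iso.refl Z
      comm := by simp [S.zero] }, hZ⟩⟩ hmono hepi

end FiniteTypeModule

/-! ### Modules over a Hom-finite category with finitely many indecomposable objects -/

namespace ModuleOver

variable {A : Type u} [Category.{v} A] [Preadditive A] [HasBinaryBiproducts A]
  (k : Type w) [Field k] [Linear k A] [∀ X Y : A, Module.Finite k (X ⟶ Y)]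
  {ι : Type*} {N : ι → A} (hN : ∀ V, Indecomposable V → ∃ i, Nonempty (V ≅ N i))
  {F G : ModuleOver A}

include k hN

/-- Submodules are determined by their sections on the indecomposable objects. -/
theorem le_of_forall_indecomposable_le {K K' : ∀ X, AddSubgroup (F.Sections X)}
    (hK : F.IsSubmodule K) (hK' : F.IsSubmodule K') (h : ∀ i, K (N i) ≤ K' (N i)) (X : A) :
    K X ≤ K' X := by
  have iso {X Y : A} (e : X ≅ Y) (h : K X ≤ K' X) : K Y ≤ K' Y := fun y hy ↦ by
    have := hK' e.inv _ (h (hK e.hom y hy))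
    rwa [← restrict_comp, e.inv_hom_id, restrict_id] at this
  refine indecomposable_induction k (P := fun X ↦ K X ≤ K' X) iso ?_ ?_ ?_ X
  · intro X hX x _
    rw [← F.restrict_id x, hX.eq_of_src (𝟙 X) 0, restrict_zero]
    exact zero_mem _
  · intro X Y hX hY x hx
    rw [← F.restrict_id x, ← biprod.total, restrict_add, restrict_comp, restrict_comp]
    exact add_mem (hK' _ _ (hX (hK _ x hx))) (hK' _ _ (hY (hK _ x hx)))
  · intro X hX
    obtain ⟨i, ⟨e⟩⟩ := hN X hX
    exact iso e.symm (h i)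

variable [Finite ι]

/-- A module with finite-dimensional sections has finite type. -/
theorem isFiniteType_of_finite_sections [HasFiniteBiproducts A]
    (hF : ∀ X, Module.Finite k (F.Sections X)) : isFiniteType A F := by
  rw [isFiniteType_iff_exists_generator]
  let n (i : ι) : ℕ := Module.finrank k (F.Sections (N i))
  let b (i : ι) := Module.finBasis k (F.Sections (N i))
  cases nonempty_fintype ι
  let V : (Σ i, Fin (n i)) → A := fun j ↦ N j.1
  -- One copy of `N i` is taken for each basis vector of `F(N i)`. Restricting `x` along the
  -- inclusions recovers these vectors, so `x` generates all sections on each `N i`.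
  let x : F.Sections (⨁ V) := ∑ j, F.restrict (biproduct.π V j) (b j.1 j.2)
  have hx (j : Σ i, Fin (n i)) : F.restrict (biproduct.ι V j) x = b j.1 j.2 := by
    rw [map_sum, Finset.sum_eq_single j]
    · rw [← restrict_comp, biproduct.ι_π_self, restrict_id]
    · intro j' _ hj'
      rw [← restrict_comp, biproduct.ι_π_ne _ hj'.symm, restrict_zero]
    · simp
  let K (X : A) : AddSubgroup (F.Sections X) := (F.restrictHom x).range
  have hK : F.IsSubmodule K := by
    rintro X Y f _ ⟨g, rfl⟩
    exact ⟨f ≫ g, F.restrict_comp f g x⟩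
  refine ⟨⨁ V, x, fun X y ↦ ?_⟩
  refine le_of_forall_indecomposable_le k hN (K := fun _ ↦ ⊤) (K' := K) (fun _ _ _ _ _ ↦ trivial)
    hK (fun i y _ ↦ ?_) X (x := y) trivial
  rw [← (b i).sum_repr y]
  refine sum_mem fun j _ ↦ ⟨(b i).repr y j • biproduct.ι V ⟨i, j⟩, ?_⟩
  exact (restrict_smul _ _ _).trans congr(_ • $(hx ⟨i, j⟩))

/-- A module with finite-dimensional sections is noetherian. -/
theorem isNoetherianObject_of_finite_sections (hF : ∀ X, Module.Finite k (F.Sections X)) :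
    IsNoetherianObject F := by
  let φ (P : Subobject F) (i : ι) : Submodule k (F.Sections (N i)) :=
    LinearMap.range (linearApp k P.arrow (N i))
  have hφ {P Q : Subobject F} (h : φ P ≤ φ Q) : P ≤ Q := by
    have key := le_of_forall_indecomposable_le k hN (isSubmodule_range P.arrow)
      (isSubmodule_range Q.arrow) fun i x hx ↦ h i hx
    obtain ⟨l, hl⟩ := exists_lift Q.arrow (injective_of_mono _) P.arrow
      fun X x ↦ key X ⟨x, rfl⟩
    exact Subobject.le_of_comm l hl
  have hφ' : Monotone φ := fun P Q h i ↦ by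
    rintro _ ⟨x, rfl⟩
    refine ⟨app (Subobject.ofLE P Q h) (N i) x, ?_⟩
    conv_rhs => rw [← Subobject.ofLE_arrow h]
    rfl
  have hφ'' : StrictMono φ := fun P Q h ↦ lt_of_le_not_ge (hφ' h.le) fun h' ↦ h.not_ge (hφ h')
  have : WellFoundedGT (∀ i, Submodule k (F.Sections (N i))) :=
    ⟨(Pi.wellFoundedLT (α := fun i ↦ (Submodule k (F.Sections (N i)))ᵒᵈ)).wf⟩
  exact isNoetherianObject.is_of_prop hφ''.wellFoundedGT

variable [HasFiniteBiproducts A]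

/-- Modules embedding into modules of finite type have finite type. -/
theorem isFiniteType_of_injective (hG : isFiniteType A G) (f : F ⟶ G)
    (hf : ∀ X, Function.Injective (app f X)) : isFiniteType A F := by
  refine isFiniteType_of_finite_sections k hN fun X ↦ ?_
  have := finite_sections (k := k) hG X
  exact Module.Finite.of_injective (linearApp k f X) (hf X)

theorem isNoetherianObject_of_isFiniteType (hF : isFiniteType A F) : IsNoetherianObject F :=
  isNoetherianObject_of_finite_sections k hN fun X ↦ finite_sections hF X

end ModuleOver

/-! ### Generators and relations of Grothendieck groups -/

namespace K0

variable {C : Type u} [Category.{v} C] [Preadditive C] {E : ObjectProperty (ShortComplex C)}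

theorem mk_eq_of_iso {X Y : C} (e : X ≅ Y) : mk E X = mk E Y := by
  have : (Quotient.mk _ X : IsoClasses C) = Quotient.mk _ Y := Quotient.sound ⟨e⟩
  rw [mk, mk, this]

theorem mk_eq_add {S : ShortComplex C} (hS : E S) : mk E S.X₂ = mk E S.X₁ + mk E S.X₃ := by
  rw [← sub_eq_zero]
  exact (QuotientAddGroup.eq_zero_iff _).2 (AddSubgroup.subset_closure ⟨S, hS, rfl⟩)

theorem addSubgroup_eq_top {H : AddSubgroup (K0 E)} (h : ∀ X, mk E X ∈ H) : H = ⊤ := by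
  rw [eq_top_iff]
  intro x hx
  clear hx
  induction x using QuotientAddGroup.induction_on with
  | H x =>
    induction x using FreeAbelianGroup.induction_on with
    | zero => exact zero_mem H
    | of x =>
      induction x using Quotient.inductionOn with
      | h X => exact h X
    | neg x hx => exact neg_mem hx
    | add x y hx hy => exact add_mem hx hy

/-- The universal property of the Grothendieck group. -/
def lift {M : Type*} [AddCommGroup M] (d : C → M) (iso : ∀ X Y, (X ≅ Y) → d X = d Y)
    (add : ∀ S, E S → d S.X₂ = d S.X₁ + d S.X₃) : K0 E →+ M :=
  QuotientAddGroup.lift _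
    (FreeAbelianGroup.lift (Quotient.lift d fun X Y ⟨e⟩ ↦ iso X Y e)) <| by
      rw [AddSubgroup.closure_le]
      rintro _ ⟨S, hS, rfl⟩
      simp [add S hS]

@[simp]
theorem lift_mk {M : Type*} [AddCommGroup M] (d : C → M) (iso) (add) (X : C) :
    lift (E := E) d iso add (mk E X) = d X :=
  FreeAbelianGroup.lift_apply_of _ _

theorem mk_biprod [HasBinaryBiproducts C] (X Y : C) :
    mk (splitExact C) (X ⊞ Y) = mk _ X + mk _ Y :=
  mk_eq_add (E := splitExact C) ⟨ShortComplex.Splitting.ofHasBinaryBiproduct X Y⟩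

/-- Direct sums make the differences of classes a subgroup, and it contains `[X] = [X ⊞ X] - [X]`.
-/
theorem exists_eq_sub [HasBinaryBiproducts C] [HasZeroObject C] (x : K0 (splitExact C)) :
    ∃ X Y : C, x = mk _ X - mk _ Y := by
  let H : AddSubgroup (K0 (splitExact C)) :=
    { carrier := {x | ∃ X Y : C, x = mk _ X - mk _ Y}
      add_mem' := by
        rintro _ _ ⟨X, Y, rfl⟩ ⟨X', Y', rfl⟩
        exact ⟨X ⊞ X', Y ⊞ Y', by rw [mk_biprod, mk_biprod]; abel⟩
      zero_mem' := by
        exact ⟨0, 0, (sub_self _).symm⟩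
      neg_mem' := by
        rintro _ ⟨X, Y, rfl⟩
        exact ⟨Y, X, neg_sub _ _⟩ }
  have hH : H = ⊤ := addSubgroup_eq_top fun X ↦ ⟨X ⊞ X, X, by rw [mk_biprod]; abel⟩
  exact (hH ▸ AddSubgroup.mem_top x : x ∈ H)

end K0

/-! ### The Grothendieck group of the modules of finite type -/

namespace FiniteTypeModule

open ModuleOver

variable {A : Type u} [Category.{v} A] [Preadditive A]

instance : (yonedaFiniteType A).Additive where
  map_add {_ _ f g} := InducedCategory.hom_ext <| hom_ext fun _ h ↦ Preadditive.comp_add _ _ _ h f g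

instance [HasZeroObject A] : HasZeroObject (FiniteTypeModule A) :=
  ⟨(yonedaFiniteType A).obj 0, isZero_yoneda_of_isZero (isZero_zero A)⟩

/-- The homomorphism of Grothendieck groups induced by the Yoneda embedding. -/
def yonedaK0 (A : Type u) [Category.{v} A] [Preadditive A] [HasZeroObject A] :
    K0 (splitExact A) →+ K0 (allExact (FiniteTypeModule A)) :=
  K0.lift (fun V ↦ K0.mk _ ((yonedaFiniteType A).obj V))
    (fun _ _ e ↦ K0.mk_eq_of_iso ((yonedaFiniteType A).mapIso e))
    fun S ⟨s⟩ ↦ K0.mk_eq_add (E := allExact (FiniteTypeModule A)) (S := S.map (yonedaFiniteType A))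
      (s.map (yonedaFiniteType A)).shortExact

@[simp]
theorem yonedaK0_mk [HasZeroObject A] (V : A) :
    yonedaK0 A (K0.mk _ V) = K0.mk _ ((yonedaFiniteType A).obj V) :=
  K0.lift_mk _ _ _ V

variable [HasFiniteBiproducts A]

theorem mk_eq_add_of_sections {F₁ F₂ F₃ : FiniteTypeModule A} (f : F₁.obj ⟶ F₂.obj)
    (g : F₂.obj ⟶ F₃.obj) (hf : ∀ X, Function.Injective (app f X))
    (hfg : ∀ X y, app g X y = 0 ↔ ∃ x, app f X x = y)
    (hg : ∀ X, Function.Surjective (app g X)) :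
    K0.mk (allExact (FiniteTypeModule A)) F₂ = K0.mk _ F₁ + K0.mk _ F₃ := by
  let S : ShortComplex (FiniteTypeModule A) :=
    { f := ObjectProperty.homMk f
      g := ObjectProperty.homMk g
      zero := InducedCategory.hom_ext <| hom_ext fun X x ↦ (hfg X _).2 ⟨x, rfl⟩ }
  exact K0.mk_eq_add (E := allExact (FiniteTypeModule A)) (S := S)
    (shortExact_of_sections S hf (fun X y ↦ (hfg X y).1) hg)

variable (k : Type w) [Field k] [Linear k A] [∀ X Y : A, Module.Finite k (X ⟶ Y)]

/-- The dimension of the space of sections on an object. -/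
def finrankSections (X : A) : K0 (allExact (FiniteTypeModule A)) →+ ℤ :=
  K0.lift (fun F ↦ Module.finrank k (F.obj.Sections X))
    (fun F G e ↦ congrArg Nat.cast <| LinearEquiv.finrank_eq <|
      LinearEquiv.ofLinearMap (linearApp k e.hom.hom X) (linearApp k e.inv.hom X)
        (LinearMap.ext fun x ↦ congr(app $(e.inv_hom_id).hom X x))
        (LinearMap.ext fun x ↦ congr(app $(e.hom_inv_id).hom X x)))
    fun S hS ↦ by rw [finrank_sections_of_shortExact k hS X, Nat.cast_add]

theorem finrankSections_yoneda (X V : A) :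
    finrankSections k X (K0.mk _ ((yonedaFiniteType A).obj V)) = Module.finrank k (X ⟶ V) :=
  (K0.lift_mk _ _ _ _).trans (congrArg Nat.cast (sectionsRepresentable k V X).finrank_eq)

variable [HasBinaryBiproducts A] [HasKernels A]

include k in
theorem nonempty_iso_of_mk_yoneda_eq [HasCokernels A] {V V' : A}
    (h : K0.mk (allExact (FiniteTypeModule A)) ((yonedaFiniteType A).obj V) =
      K0.mk _ ((yonedaFiniteType A).obj V')) : Nonempty (V ≅ V') := by
  refine nonempty_iso_of_finrank_hom_eq k fun X ↦ ?_
  have := congrArg (finrankSections k X) h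
  rwa [finrankSections_yoneda, finrankSections_yoneda, Nat.cast_inj] at this

include k in
theorem yonedaK0_injective [HasCokernels A] : Function.Injective (yonedaK0 A) := by
  rw [injective_iff_map_eq_zero]
  intro x hx
  obtain ⟨V, V', rfl⟩ := K0.exists_eq_sub x
  rw [map_sub, yonedaK0_mk, yonedaK0_mk, sub_eq_zero] at hx
  obtain ⟨e⟩ := nonempty_iso_of_mk_yoneda_eq k hx
  rw [K0.mk_eq_of_iso e, sub_self]

-- This is where a resolution of `F` by representables of length two is built, cut into the short
-- exact sequences giving `h1` and `h2`.
include k in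
theorem yonedaK0_surjective {ι : Type*} [Finite ι] {N : ι → A}
    (hN : ∀ V, Indecomposable V → ∃ i, Nonempty (V ≅ N i)) :
    Function.Surjective (yonedaK0 A) := by
  rw [← AddMonoidHom.range_eq_top]
  refine K0.addSubgroup_eq_top fun F ↦ ?_
  obtain ⟨V, x, hx⟩ := isFiniteType_iff_exists_generator.1 F.2
  have hK := isSubmodule_ker (ofSection x)
  let K : FiniteTypeModule A :=
    ⟨ofSubmodule hK, isFiniteType_of_injective k hN (isFiniteType_representable V)
      (submoduleι hK) (submoduleι_injective hK)⟩
  obtain ⟨U, y, hy⟩ := isFiniteType_iff_exists_generator.1 K.2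
  -- As a section of `A(·, V)` over `U`, the generator of `K` is a morphism; composition with it is
  -- `A(·, U) ⟶ K ⟶ A(·, V)`.
  let u : U ⟶ V := app (submoduleι hK) U y
  have hu (X : A) (f : X ⟶ U) : app (ofSection y) X f = 0 ↔ f ≫ u = 0 := by
    rw [app_ofSection, ← (injective_iff_map_eq_zero' _).1 (submoduleι_injective hK X),
      app_restrict]
    rfl
  have h1 := mk_eq_add_of_sections (F₁ := K) (F₂ := (yonedaFiniteType A).obj V) (F₃ := F)
    (submoduleι hK) (ofSection x) (submoduleι_injective hK)
    (fun X y ↦ (exists_app_submoduleι_iff hK y).symm) hx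
  have h2 := mk_eq_add_of_sections (F₁ := (yonedaFiniteType A).obj (kernel u))
    (F₂ := (yonedaFiniteType A).obj U) (F₃ := K)
    ((representable A).map (kernel.ι u)) (ofSection y)
    (fun X f g h ↦ (cancel_mono (Z := X) (kernel.ι u)).1 h)
    (fun X f ↦ (hu X f).trans <| by
      refine ⟨fun h ↦ ⟨kernel.lift u f h, kernel.lift_ι u f h⟩, ?_⟩
      rintro ⟨g, rfl⟩
      exact (Category.assoc (W := X) g _ _).trans
        ((congrArg (g ≫ ·) (kernel.condition u)).trans comp_zero)) hy
  refine ⟨K0.mk _ V - (K0.mk _ U - K0.mk _ (kernel u)), ?_⟩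
  rw [map_sub, map_sub, yonedaK0_mk, yonedaK0_mk, yonedaK0_mk, h1, h2]
  abel

end FiniteTypeModule

/-! ### Finite-dimensional algebras -/

section Algebra

open ModuleCat

variable (k : Type w) [Field k] {R : Type u} [Ring R] [Algebra k R] [Module.Finite k R]

/-- Module homomorphisms form a subspace of the `k`-linear maps between finite-dimensional spaces.
-/
theorem RightMod.finite_hom (V W : RightMod R) : Module.Finite k (V ⟶ W) := by
  have (V : RightMod R) : Module.Finite k V.obj := Module.Finite.trans Rᵐᵒᵖ V.obj
  let f : (V ⟶ W) →ₗ[k] (V.obj →ₗ[k] W.obj) :=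
    { toFun f := f.hom.hom.restrictScalars k
      map_add' _ _ := rfl
      map_smul' _ _ := rfl }
  refine Module.Finite.of_injective f fun g h hgh ↦ ?_
  ext x
  exact congr($hgh x)

end Algebra

end

theorem theorem2 {k : Type w} [Field k] [IsAlgClosed k] {R : Type u} [Ring R] [Algebra k R]
    [Module.Finite k R] (hR : FiniteRepresentationType R) :
    IsRightNoetherian (RightMod R) ∧
    (∃ φ : K0 (splitExact (RightMod R)) ≃+ K0 (allExact (FiniteTypeModule (RightMod R))),
      ∀ V : RightMod R, φ (K0.mk _ V) = K0.mk _ ((yonedaFiniteType (RightMod R)).obj V)) ∧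
    (∀ V V' : RightMod R, Nonempty (V ≅ V') ↔
      K0.mk (allExact (FiniteTypeModule (RightMod R))) ((yonedaFiniteType (RightMod R)).obj V) =
        K0.mk (allExact (FiniteTypeModule (RightMod R)))
          ((yonedaFiniteType (RightMod R)).obj V')) := by
  have : IsNoetherianRing Rᵐᵒᵖ := isNoetherian_of_tower k (inferInstance : IsNoetherian k Rᵐᵒᵖ)
  have : HasFiniteBiproducts (RightMod R) := HasFiniteBiproducts.of_hasFiniteProducts
  have := RightMod.finite_hom k (R := R)
  have : Finite {c : IsoClasses (RightMod R) |
    ∃ V : RightMod R, Indecomposable V ∧ Quotient.mk _ V = c} := hR.to_subtype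
  -- The finite index set is the set of indecomposable classes itself, with a chosen representative
  -- of each class as `N c`.
  have hN (V : RightMod R) (hV : Indecomposable V) : ∃ c : {c : IsoClasses (RightMod R) |
      ∃ V : RightMod R, Indecomposable V ∧ Quotient.mk _ V = c}, Nonempty (V ≅ c.1.out) :=
    ⟨⟨_, V, hV, rfl⟩, (Quotient.mk_out (s := isIsomorphicSetoid _) V).map Iso.symm⟩
  refine ⟨fun V ↦ ModuleOver.isNoetherianObject_of_isFiniteType k hN (isFiniteType_representable V),
    ⟨AddEquiv.ofBijective (FiniteTypeModule.yonedaK0 (RightMod R))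
      ⟨FiniteTypeModule.yonedaK0_injective k, FiniteTypeModule.yonedaK0_surjective k hN⟩,
      FiniteTypeModule.yonedaK0_mk⟩,
    fun V V' ↦ ⟨fun ⟨e⟩ ↦ K0.mk_eq_of_iso ((yonedaFiniteType _).mapIso e),
      FiniteTypeModule.nonempty_iso_of_mk_yoneda_eq k⟩⟩
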